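/- Graphs are finite and may have loops and parallel edges. For a graph $G$ let $\Delta(G)=|E(G)|-|V(G)|$, for $X\subseteq E(G)$ let $G\langle X\rangle$ be the subgraph formed by the edges in $X$ and their ends, and let $S(v,G)$ be the set of edges incident to the vertex $v$ (the star of $v$) and $\mathcal S(G)=\{S(v,G):v\in V(G)\}$. For $k\ge 1$ let $M_k(G)$ be the $k$-circular matroid of $G$: the matroid on $E(G)$ whose circuits are the sets $C\subseteq E(G)$ such that $\Delta(G\langle C\rangle)=k$ and $G\langle C\rangle$ has no isolated vertices, no leaves (vertices of degree $1$, a loop counting twice), and no component that is a cycle. A matroid is connected if it has no loops, no coloops, and every two of its elements belong to a common circuit; a cocircuit $K$ of a connected matroid $M$ is non-separating if $M\setminus K$ is connected. Graphs $G$ and $G'$ with $E(G)=E(G')$ are strongly isomorphic if there is a bijection $\nu:V(G)\to V(G')$ such that every edge $e$ has ends $x,y$ in $G$ if and only if it has ends $\nu(x),\nu(y)$ in $G'$. Theorem. Let $k\ge 1$, and let $G$ and $G'$ be finite graphs, where $G'$ has no isolated vertices. Suppose that (a1) $M_k(G)$ is a connected matroid, (a2) every vertex star $S\in\mathcal S(G)$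 is a non-separating cocircuit of $M_k(G)$, and (a3) $M_k(G)=M_k(G')$. Then $\mathcal S(G)=\mathcal S(G')$, and $G$ and $G'$ are strongly isomorphic. -/

import Mathlib

open scoped Graph Matroid

/-! ### Finite multigraphs (loops and parallel edges allowed) -/

namespace Graph

variable {α α' β : Type*}

/-- The degree of a vertex; a loop counts twice. -/
noncomputable def degree (G : Graph α β) (v : α) : ℕ :=
  (G.incidenceSet v).ncard + (G.loopSet v).ncard

/-- `G` is connected: it has a vertex, and any two vertices are joined by a walk. -/
def IsConnected (G : Graph α β) : Prop :=
  V(G).Nonempty ∧ ∀ x ∈ V(G), ∀ y ∈ V(G), Relation.ReflTransGen G.Adj x y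

/-- `G` is a cycle: it is connected and all its degrees are two. (One vertex with a loop and
two vertices joined by two parallel edges are cycles.) -/
def IsCycle (G : Graph α β) : Prop :=
  G.IsConnected ∧ ∀ v ∈ V(G), G.degree v = 2

/-- `K` is a connected component of `G`. -/
def IsComponent (K G : Graph α β) : Prop :=
  K ≤c G ∧ K.IsConnected

/-- A cacti-graph: no isolated vertices, no leaves, no component that is a cycle. -/
def IsCactiGraph (G : Graph α β) : Prop :=
  (∀ v ∈ V(G), ∃ e, G.Inc e v) ∧ (∀ v ∈ V(G), G.degree v ≠ 1) ∧
    ¬ ∃ K : Graph α β, K.IsComponent G ∧ K.IsCycle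

/-- `Δ(G) = |E(G)| - |V(G)|`. -/
noncomputable def Delta (G : Graph α β) : ℤ :=
  (E(G).ncard : ℤ) - V(G).ncard

/-- The set of vertices incident to an edge in `X`. -/
def endSet (G : Graph α β) (X : Set β) : Set α :=
  {v | ∃ e ∈ X, G.Inc e v}

/-- The subgraph `G⟨X⟩` induced by the edge set `X`: its edges are those in `X`, its
vertices are the ends of the edges in `X`. -/
def edgeInduced (G : Graph α β) (X : Set β) : Graph α β where
  vertexSet := G.endSet X
  edgeSet := E(G) ∩ X
  IsLink e x y := e ∈ X ∧ G.IsLink e x y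
  isLink_symm e _ := { symm := fun _ _ h => ⟨h.1, h.2.symm⟩ }
  eq_or_eq_of_isLink_of_isLink _ _ _ _ _ h h' := h.2.left_eq_or_eq h'.2
  edge_mem_iff_exists_isLink e := by
    constructor
    · rintro ⟨h, hX⟩
      obtain ⟨x, y, h⟩ := exists_isLink_of_mem_edgeSet h
      exact ⟨x, y, hX, h⟩
    · rintro ⟨x, y, hX, h⟩
      exact ⟨h.edge_mem, hX⟩
  left_mem_of_isLink e x _ h := ⟨e, h.1, h.2.inc_left⟩

/-- Membership in the family `C_k(G)`: edge sets `C` with `Δ(G⟨C⟩) = k` for which `G⟨C⟩` is a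
cacti-graph. -/
def IsKCircuit (G : Graph α β) (k : ℕ) (C : Set β) : Prop :=
  C ⊆ E(G) ∧ (G.edgeInduced C).Delta = k ∧ (G.edgeInduced C).IsCactiGraph

/-- The set `S(G)` of all vertex stars of `G`. -/
def starSet (G : Graph α β) : Set (Set β) :=
  {S | ∃ v ∈ V(G), S = G.incidenceSet v}

/-- Strong isomorphism: the edge sets coincide and some bijection of the vertex sets preserves
the ends of every edge. -/
def StronglyIsomorphic (G : Graph α β) (G' : Graph α' β) : Prop :=
  E(G) = E(G') ∧ ∃ ν : V(G) ≃ V(G'), ∀ (e : β) (x y : V(G)),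
    G.IsLink e x y ↔ G'.IsLink e (ν x) (ν y)

/-! ### The sets `C_k(G)` are the circuits of a matroid -/

/-- `|X|` minus the number of vertices met by `X`. -/
noncomputable def excess (G : Graph α β) (X : Set β) : ℤ :=
  (X.ncard : ℤ) - (G.endSet X).ncard

theorem endSet_finite (G : Graph α β) {X : Set β} (hX : X.Finite) : (G.endSet X).Finite := by
  have h : G.endSet X = ⋃ e ∈ X, {v | G.Inc e v} := by
    ext v; simp [endSet]
  rw [h]
  refine hX.biUnion fun e _ => ?_
  by_cases he : ∃ x y, G.IsLink e x y
  · obtain ⟨x, y, hxy⟩ := he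
    refine (Set.toFinite {x, y}).subset fun v hv => ?_
    exact Inc.eq_or_eq_of_isLink hv hxy
  · refine Set.finite_empty.subset fun v hv => ?_
    obtain ⟨w, hw⟩ := hv
    exact he ⟨_, _, hw⟩

theorem endSet_mono (G : Graph α β) {X Y : Set β} (h : X ⊆ Y) : G.endSet X ⊆ G.endSet Y :=
  fun _ ⟨e, he, hv⟩ => ⟨e, h he, hv⟩

theorem excess_supermodular (G : Graph α β) {X Y : Set β} (hX : X.Finite) (hY : Y.Finite) :
    G.excess X + G.excess Y ≤ G.excess (X ∪ Y) + G.excess (X ∩ Y) := by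
  have h1 := Set.ncard_union_add_ncard_inter X Y hX hY
  have h2 := Set.ncard_union_add_ncard_inter _ _ (G.endSet_finite hX) (G.endSet_finite hY)
  have h3 : G.endSet (X ∪ Y) = G.endSet X ∪ G.endSet Y := by
    ext v; simp only [endSet, Set.mem_ofPred_eq, Set.mem_union]; grind
  have h4 : (G.endSet (X ∩ Y)).ncard ≤ (G.endSet X ∩ G.endSet Y).ncard :=
    Set.ncard_le_ncard (Set.subset_inter (G.endSet_mono Set.inter_subset_left)
      (G.endSet_mono Set.inter_subset_right)) ((G.endSet_finite hX).inter_of_left _)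
  unfold excess
  rw [h3]
  omega

theorem edgeInduced_delta (G : Graph α β) {X : Set β} (hX : X ⊆ E(G)) :
    (G.edgeInduced X).Delta = G.excess X := by
  unfold Delta excess
  congr 2
  exact congrArg _ (Set.inter_eq_right.2 hX)

/-- Removing a set `D` of edges that contains all edges of `X` at a set `W` of vertices met
by `X`, where `|D| ≤ |W|`, does not decrease the excess. -/
theorem excess_le_excess_sdiff (G : Graph α β) {X D : Set β} {W : Set α} (hX : X.Finite)
    (hDX : D ⊆ X) (hW : W ⊆ G.endSet X) (hD : ∀ e ∈ X, ∀ w ∈ W, G.Inc e w → e ∈ D)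
    (hcard : D.ncard ≤ W.ncard) : G.excess X ≤ G.excess (X \ D) := by
  have h1 := Set.ncard_sdiff_add_ncard_of_subset hDX hX
  have h2 := Set.ncard_sdiff_add_ncard_of_subset hW (G.endSet_finite hX)
  have h3 : (G.endSet (X \ D)).ncard ≤ (G.endSet X \ W).ncard := by
    refine Set.ncard_le_ncard ?_ ((G.endSet_finite hX).subset Set.sdiff_subset)
    rintro v ⟨e, he, hv⟩
    exact ⟨⟨e, he.1, hv⟩, fun hvW => he.2 (hD e he.1 v hvW hv)⟩
  unfold excess
  omega

open scoped Classical in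
/-- The number of ends of `e` (counted with multiplicity) in the set `W`. -/
noncomputable def endCount (H : Graph α β) (W : Finset α) (e : β) : ℕ :=
  ∑ w ∈ W, ((if H.Inc e w then 1 else 0) + (if H.IsLoopAt e w then 1 else 0))

open scoped Classical in
theorem endCount_eq {H : Graph α β} {W : Finset α} {e : β} {x y : α} (h : H.IsLink e x y) :
    H.endCount W e = (if x ∈ W then 1 else 0) + (if y ∈ W then 1 else 0) := by
  have h1 : ∀ w, (if H.Inc e w then 1 else 0) + (if H.IsLoopAt e w then 1 else 0)
      = (if x = w then 1 else 0) + (if y = w then 1 else 0) := by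
    intro w
    have hi : H.Inc e w ↔ x = w ∨ y = w :=
      ⟨fun hw => (hw.eq_or_eq_of_isLink h).imp Eq.symm Eq.symm, by
        rintro (rfl | rfl)
        exacts [h.inc_left, h.inc_right]⟩
    have hl : H.IsLoopAt e w ↔ x = w ∧ y = w :=
      ⟨fun hw => ⟨(hw.eq_of_inc h.inc_left).symm, (hw.eq_of_inc h.inc_right).symm⟩, by
        rintro ⟨rfl, rfl⟩
        exact h⟩
    by_cases hx : x = w <;> by_cases hy : y = w <;> simp [hi, hl, hx, hy]
  unfold endCount
  simp only [h1, Finset.sum_add_distrib, Finset.sum_ite_eq]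

open scoped Classical in
theorem sum_degree (H : Graph α β) (hE : E(H).Finite) (W : Finset α) :
    ∑ w ∈ W, H.degree w = ∑ e ∈ hE.toFinset, H.endCount W e := by
  unfold endCount
  rw [Finset.sum_comm]
  refine Finset.sum_congr rfl fun w _ => ?_
  rw [Finset.sum_add_distrib, Finset.sum_boole, Finset.sum_boole, degree]
  congr 1
  · rw [← Set.ncard_coe_finset]
    simp only [Nat.cast_id]
    congr 1; ext e
    simpa using fun h : H.Inc e w => h.edge_mem
  · rw [← Set.ncard_coe_finset]
    simp only [Nat.cast_id]
    congr 1; ext e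
    simpa using fun h : H.IsLoopAt e w => h.edge_mem

/-- A cycle has as many edges as vertices. -/
theorem IsCycle.ncard_le {K : Graph α β} (hK : K.IsCycle) (hV : V(K).Finite)
    (hE : E(K).Finite) : E(K).ncard ≤ V(K).ncard := by
  classical
  have h := K.sum_degree hE hV.toFinset
  have h1 : ∑ v ∈ hV.toFinset, K.degree v = ∑ v ∈ hV.toFinset, 2 :=
    Finset.sum_congr rfl fun v hv => hK.2 v (by simpa using hv)
  have h2 : ∑ e ∈ hE.toFinset, K.endCount hV.toFinset e = ∑ e ∈ hE.toFinset, 2 := by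
    refine Finset.sum_congr rfl fun e he => ?_
    obtain ⟨x, y, hxy⟩ := exists_isLink_of_mem_edgeSet (hE.mem_toFinset.1 he)
    rw [endCount_eq hxy]
    simp [hxy.left_mem, hxy.right_mem]
  rw [h1, h2] at h
  rw [Set.ncard_eq_toFinset_card _ hV, Set.ncard_eq_toFinset_card _ hE]
  simp only [Finset.sum_const, smul_eq_mul] at h
  omega

/-- If a set `W` of vertices of degree at least two meets at most `|W|` edges, then some
component is a cycle. -/
theorem exists_cycle_component (H : Graph α β) (hE : E(H).Finite) {W : Set α} (hWf : W.Finite)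
    (hWne : W.Nonempty) (hWV : W ⊆ V(H)) (hdeg : ∀ w ∈ W, 2 ≤ H.degree w)
    (hcard : {e | ∃ w ∈ W, H.Inc e w}.ncard ≤ W.ncard) :
    ∃ K : Graph α β, K.IsComponent H ∧ K.IsCycle := by
  classical
  set D : Set β := {e | ∃ w ∈ W, H.Inc e w} with hDdef
  have hDE : D ⊆ E(H) := fun e ⟨w, _, h⟩ => h.edge_mem
  have hDf : D.Finite := hE.subset hDE
  have hle : ∀ e ∈ hE.toFinset, H.endCount hWf.toFinset e ≤ if e ∈ D then 2 else 0 := by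
    intro e he
    obtain ⟨x, y, hxy⟩ := exists_isLink_of_mem_edgeSet (hE.mem_toFinset.1 he)
    rw [endCount_eq hxy]
    by_cases hD : e ∈ D
    · rw [if_pos hD]; split_ifs <;> omega
    · have hx : x ∉ W := fun h => hD ⟨x, h, hxy.inc_left⟩
      have hy : y ∉ W := fun h => hD ⟨y, h, hxy.inc_right⟩
      simp [hx, hy]
  have hsumD : ∑ e ∈ hE.toFinset, (if e ∈ D then 2 else 0) = 2 * D.ncard := by
    rw [← Finset.sum_filter, Finset.sum_const, smul_eq_mul, mul_comm,
      ← Set.ncard_coe_finset]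
    congr 2; ext e
    simpa using fun h => hDE h
  have hsumW : 2 * W.ncard = ∑ w ∈ hWf.toFinset, 2 := by
    rw [Finset.sum_const, smul_eq_mul, mul_comm, Set.ncard_eq_toFinset_card _ hWf]
  have hdeg' : ∀ w ∈ hWf.toFinset, 2 ≤ H.degree w := fun w hw => hdeg w (by simpa using hw)
  have h1 := Finset.sum_le_sum hdeg'
  have h2 := Finset.sum_le_sum hle
  have h3 := H.sum_degree hE hWf.toFinset
  have hdeg2 : ∀ w ∈ W, H.degree w = 2 := by
    have := (Finset.sum_eq_sum_iff_of_le hdeg').1 (by omega)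
    exact fun w hw => (this w (by simpa using hw)).symm
  have hend : ∀ e ∈ D, H.endCount hWf.toFinset e = 2 := by
    have := (Finset.sum_eq_sum_iff_of_le hle).1 (by omega)
    intro e he
    rw [this e (by simpa using hDE he), if_pos he]
  have hclosed : ∀ x y, x ∈ W → H.Adj x y → y ∈ W := by
    rintro x y hx ⟨e, he⟩
    have := hend e ⟨x, hx, he.inc_left⟩
    rw [endCount_eq he] at this
    by_contra hy
    simp [hx, hy] at this
  obtain ⟨w, hw⟩ := hWne
  set U : Set α := {v | Relation.ReflTransGen H.Adj w v} with hU
  have hUW : U ⊆ W := by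
    intro v hv
    induction hv with
    | refl => exact hw
    | tail _ h ih => exact hclosed _ _ ih h
  have hcl : H.induce U ≤c H := by
    refine IsClosedSubgraph.mk' (induce_le (hUW.trans hWV)) fun e x he hx => ?_
    obtain ⟨y, hy⟩ := he
    exact ⟨x, y, hy, hx, Relation.ReflTransGen.tail hx ⟨e, hy⟩⟩
  have hreach : ∀ v ∈ U, Relation.ReflTransGen (H.induce U).Adj w v := by
    intro v hv
    induction hv with
    | refl => exact .refl
    | tail h1 h2 ih =>
      obtain ⟨e, he⟩ := h2
      exact ih.tail ⟨e, he, h1, h1.tail ⟨e, he⟩⟩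
  have hconn : (H.induce U).IsConnected := by
    refine ⟨⟨w, Relation.ReflTransGen.refl⟩, fun x hx y hy => ?_⟩
    have hs : ∀ a b, (H.induce U).Adj a b → (H.induce U).Adj b a :=
      fun a b ⟨e, he⟩ => ⟨e, he.symm⟩
    have h := hreach x hx
    have h' : Relation.ReflTransGen (H.induce U).Adj x w := by
      rw [← Relation.reflTransGen_swap]
      exact Relation.ReflTransGen.mono (fun a b hab => hs a b hab) _ _ h
    exact h'.trans (hreach y hy)
  refine ⟨H.induce U, ⟨hcl, hconn⟩, hconn, fun v hv => ?_⟩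
  rw [← hdeg2 v (hUW hv), degree, degree]
  congr 2
  · ext e
    exact hcl.inc_congr hv
  · ext e
    exact hcl.isLink_congr hv

theorem edgeInduced_inc {G : Graph α β} {X : Set β} {e : β} {v : α} :
    (G.edgeInduced X).Inc e v ↔ e ∈ X ∧ G.Inc e v :=
  ⟨fun ⟨y, h, h'⟩ => ⟨h, y, h'⟩, fun ⟨h, y, h'⟩ => ⟨y, h, h'⟩⟩

/-- Every finite edge set `X` with `|X| - |V(X)| ≥ k ≥ 1` contains a member of `C_k(G)`. -/
theorem exists_isKCircuit (G : Graph α β) {k : ℕ} (hk : 1 ≤ k) {X : Set β} (hX : X.Finite)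
    (hXE : X ⊆ E(G)) (hex : (k : ℤ) ≤ G.excess X) : ∃ C ⊆ X, G.IsKCircuit k C := by
  classical
  obtain ⟨C, hCX, hCmin⟩ : ∃ C ⊆ X, Minimal (fun Y => Y ⊆ X ∧ (k : ℤ) ≤ G.excess Y) C := by
    have hf : {Y | Y ⊆ X ∧ (k : ℤ) ≤ G.excess Y}.Finite :=
      hX.finite_subsets.subset fun Y h => h.1
    exact hf.exists_le_minimal (a := X) ⟨subset_rfl, hex⟩
  have hCf := hX.subset hCX
  have hCE := hCX.trans hXE
  have hmin : ∀ D ⊆ C, D.Nonempty → G.excess (C \ D) < k := by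
    intro D hD hDne
    by_contra! hcon
    have := hCmin.2 ⟨Set.sdiff_subset.trans hCX, hcon⟩ Set.sdiff_subset
    obtain ⟨e, he⟩ := hDne
    exact (this (hD he)).2 he
  have hdrop : ∀ (D : Set β) (W : Set α), D ⊆ C → D.Nonempty → W ⊆ G.endSet C →
      (∀ e ∈ C, ∀ w ∈ W, G.Inc e w → e ∈ D) → D.ncard ≤ W.ncard → False := by
    intro D W hD hDne hW hDW hc
    have := G.excess_le_excess_sdiff hCf hD hW hDW hc
    have := hmin D hD hDne
    have := hCmin.1.2
    omega
  refine ⟨C, hCX, hCE, ?_, ?_, ?_, ?_⟩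
  · rw [G.edgeInduced_delta hCE]
    refine le_antisymm ?_ hCmin.1.2
    have hne : C.Nonempty := by
      by_contra h
      rw [Set.not_nonempty_iff_eq_empty] at h
      have := hCmin.1.2
      simp [h, excess, endSet] at this
      omega
    obtain ⟨e, he⟩ := hne
    have h1 := hmin {e} (by simpa using he) (by simp)
    have h2 := Set.ncard_sdiff_singleton_add_one he hCf
    have h3 : (G.endSet (C \ {e})).ncard ≤ (G.endSet C).ncard :=
      Set.ncard_le_ncard (G.endSet_mono Set.sdiff_subset) (G.endSet_finite hCf)
    unfold excess at *
    omega
  · rintro v ⟨e, he, hv⟩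
    exact ⟨e, edgeInduced_inc.2 ⟨he, hv⟩⟩
  · rintro v ⟨e, he, hv⟩ hdeg
    have hfin : ((G.edgeInduced C).incidenceSet v).Finite :=
      hCf.subset fun f hf => (edgeInduced_inc.1 hf).1
    have hmem : e ∈ (G.edgeInduced C).incidenceSet v := edgeInduced_inc.2 ⟨he, hv⟩
    have hpos := (Set.ncard_pos hfin).2 ⟨e, hmem⟩
    refine hdrop ((G.edgeInduced C).incidenceSet v) {v}
      (fun f hf => (edgeInduced_inc.1 hf).1) ⟨e, hmem⟩ ?_ ?_ ?_
    · rintro _ rfl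
      exact ⟨e, he, hv⟩
    · rintro f hf _ rfl hfw
      exact edgeInduced_inc.2 ⟨hf, hfw⟩
    · rw [Set.ncard_singleton]
      unfold degree at hdeg
      omega
  · rintro ⟨K, ⟨hKc, hKne, -⟩, hKcyc⟩
    have hVK : V(K) ⊆ G.endSet C := hKc.le.vertexSet_mono
    have hEK : E(K) ⊆ C := fun e he => (hKc.le.edgeSet_mono he).2
    have hEC : ∀ e ∈ C, ∀ w ∈ V(K), G.Inc e w → e ∈ E(K) :=
      fun e he w hw hew => hKc.closed (edgeInduced_inc.2 ⟨he, hew⟩) hw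
    refine hdrop E(K) V(K) hEK ?_ hVK hEC
      (hKcyc.ncard_le ((G.endSet_finite hCf).subset hVK) (hCf.subset hEK))
    obtain ⟨w, hw⟩ := hKne
    obtain ⟨e, he, hew⟩ := hVK hw
    exact ⟨e, hEC e he w hw hew⟩

/-- Proper subsets of a member of `C_k(G)` have smaller excess. -/
theorem IsKCircuit.excess_lt {G : Graph α β} {k : ℕ} {C : Set β} (hC : G.IsKCircuit k C)
    (hCf : C.Finite) {Y : Set β} (hY : Y ⊂ C) : G.excess Y < k := by
  obtain ⟨hCE, hdel, hiso, hleaf, hcyc⟩ := hC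
  rw [G.edgeInduced_delta hCE] at hdel
  by_contra! hcon
  have hYC := hY.subset
  have hcard := Set.ncard_lt_ncard hY hCf
  have h1 := Set.ncard_sdiff_add_ncard_of_subset hYC hCf
  have h2 := Set.ncard_sdiff_add_ncard_of_subset (G.endSet_mono hYC) (G.endSet_finite hCf)
  unfold excess at *
  have hWf : (G.endSet C \ G.endSet Y).Finite := (G.endSet_finite hCf).subset Set.sdiff_subset
  refine hcyc ((G.edgeInduced C).exists_cycle_component (hCf.subset Set.inter_subset_right)
    hWf ?_ Set.sdiff_subset ?_ ?_)
  · rw [← Set.ncard_pos hWf]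
    omega
  · intro w hw
    have ha := hleaf w hw.1
    obtain ⟨e, he⟩ := hiso w hw.1
    have hfin : ((G.edgeInduced C).incidenceSet w).Finite :=
      hCf.subset fun f hf => (edgeInduced_inc.1 hf).1
    have hpos := (Set.ncard_pos hfin).2 ⟨e, he⟩
    unfold degree at *
    omega
  · refine (Set.ncard_le_ncard (t := C \ Y) ?_ (hCf.subset Set.sdiff_subset)).trans (by omega)
    rintro e ⟨w, hw, hew⟩
    have := edgeInduced_inc.1 hew
    exact ⟨this.1, fun heY => hw.2 ⟨e, heY, this.2⟩⟩

/-- A subset of `E(G)` that contains no member of `C_k(G)`. -/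
def KIndep (G : Graph α β) (k : ℕ) (I : Set β) : Prop :=
  I ⊆ E(G) ∧ ∀ C, G.IsKCircuit k C → ¬ C ⊆ I

theorem kIndep_iff (G : Graph α β) {k : ℕ} (hk : 1 ≤ k) (hE : E(G).Finite) {I : Set β} :
    G.KIndep k I ↔ I ⊆ E(G) ∧ ∀ Y ⊆ I, G.excess Y < k := by
  refine and_congr_right fun hI => ⟨fun h Y hY => ?_, fun h C hC hCI => ?_⟩
  · by_contra! hcon
    obtain ⟨C, hCY, hC⟩ := G.exists_isKCircuit hk (hE.subset (hY.trans hI)) (hY.trans hI) hcon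
    exact h C hC (hCY.trans hY)
  · have := h C hCI
    rw [← G.edgeInduced_delta hC.1, hC.2.1] at this
    exact lt_irrefl _ this

theorem KIndep.augment {G : Graph α β} {k : ℕ} (hk : 1 ≤ k) (hE : E(G).Finite) {I J : Set β}
    (hI : G.KIndep k I) (hJ : G.KIndep k J) (hIJ : I.ncard < J.ncard) :
    ∃ e ∈ J, e ∉ I ∧ G.KIndep k (insert e I) := by
  classical
  rw [G.kIndep_iff hk hE] at hI hJ
  by_contra! hcon
  have hIf := hE.subset hI.1
  have hJf := hE.subset hJ.1
  -- a tight subset of `I` for every edge of `J` outside `I`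
  have htight : ∀ e ∈ J, e ∉ I → ∃ T ⊆ I, (k : ℤ) ≤ G.excess T + 1 ∧
      ∀ v, G.Inc e v → v ∈ G.endSet T := by
    intro e heJ heI
    have h := hcon e heJ heI
    rw [G.kIndep_iff hk hE, not_and] at h
    have h := h (Set.insert_subset (hJ.1 heJ) hI.1)
    push Not at h
    obtain ⟨Y, hY, hYk⟩ := h
    have heY : e ∈ Y := by
      by_contra heY
      have := hI.2 Y ((Set.subset_insert_iff_of_notMem heY).1 hY)
      omega
    have hYf : Y.Finite := (hIf.insert e).subset hY
    have hTI : Y \ {e} ⊆ I := by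
      rintro f ⟨hf, hfe⟩
      exact (hY hf).resolve_left hfe
    have h1 := Set.ncard_sdiff_singleton_add_one heY hYf
    have hsub : G.endSet (Y \ {e}) ⊆ G.endSet Y := G.endSet_mono Set.sdiff_subset
    have h2 := Set.ncard_le_ncard hsub (G.endSet_finite hYf)
    have h3 := hI.2 _ hTI
    unfold excess at *
    refine ⟨Y \ {e}, hTI, by omega, fun v hv => ?_⟩
    have heq := Set.eq_of_subset_of_ncard_le hsub (by omega) (G.endSet_finite hYf)
    rw [heq]
    exact ⟨e, heY, hv⟩
  obtain ⟨e₀, he₀J, he₀I⟩ : ∃ e ∈ J, e ∉ I := by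
    by_contra! h
    exact absurd (Set.ncard_le_ncard h hIf) (by omega)
  obtain ⟨T₀, hT₀I, hT₀, -⟩ := htight e₀ he₀J he₀I
  -- a largest tight subset of `I`
  obtain ⟨T, hT⟩ : ∃ T, Maximal (fun T => T ⊆ I ∧ (k : ℤ) ≤ G.excess T + 1) T := by
    have hf : {T | T ⊆ I ∧ (k : ℤ) ≤ G.excess T + 1}.Finite :=
      hIf.finite_subsets.subset fun T h => h.1
    obtain ⟨T, -, hT⟩ := hf.exists_le_maximal (a := T₀) ⟨hT₀I, hT₀⟩
    exact ⟨T, hT⟩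
  have hTI : T ⊆ I := hT.1.1
  have hTf := hIf.subset hTI
  have hall : ∀ e ∈ J, e ∉ I → ∀ v, G.Inc e v → v ∈ G.endSet T := by
    intro e heJ heI v hv
    obtain ⟨T', hT'I, hT', hT'v⟩ := htight e heJ heI
    have h1 := G.excess_supermodular hTf (hIf.subset hT'I)
    have h2 := hI.2 (T ∩ T') (Set.inter_subset_left.trans hTI)
    have h3 := hT.1.2
    have h4 : T ∪ T' ⊆ T := hT.2 ⟨Set.union_subset hTI hT'I, by omega⟩ Set.subset_union_left
    exact G.endSet_mono (Set.subset_union_right.trans h4) (hT'v v hv)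
  have hsub : G.endSet ((J \ I) ∪ (J ∩ T)) ⊆ G.endSet T := by
    rintro v ⟨e, he | he, hv⟩
    · exact hall e he.1 he.2 v hv
    · exact ⟨e, he.2, hv⟩
  have h1 := hJ.2 ((J \ I) ∪ (J ∩ T)) (Set.union_subset Set.sdiff_subset Set.inter_subset_left)
  have h2 := Set.ncard_le_ncard hsub (G.endSet_finite hTf)
  have h3 := hT.1.2
  have h4 : ((J \ I) ∪ (J ∩ T)).ncard = (J \ I).ncard + (J ∩ T).ncard :=
    Set.ncard_union_eq (Set.disjoint_left.2 fun e he he' => he.2 (hTI he'.2))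
      (hJf.subset Set.sdiff_subset) (hJf.subset Set.inter_subset_left)
  have h5 : (J ∩ I).ncard + (J \ I).ncard = J.ncard := Set.ncard_inter_add_ncard_sdiff_eq_ncard J I hJf
  have h6 : (T ∩ J).ncard + (T \ J).ncard = T.ncard := Set.ncard_inter_add_ncard_sdiff_eq_ncard T J hTf
  have h7 : (I ∩ J).ncard + (I \ J).ncard = I.ncard := Set.ncard_inter_add_ncard_sdiff_eq_ncard I J hIf
  have h8 : (T \ J).ncard ≤ (I \ J).ncard :=
    Set.ncard_le_ncard (Set.sdiff_subset_sdiff_left hTI) (hIf.subset Set.sdiff_subset)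
  rw [Set.inter_comm J I] at h5
  rw [Set.inter_comm T J] at h6
  unfold excess at *
  rw [h4] at h1
  omega

/-- The `k`-circular matroid `M_k(G)` of a graph `G` with finitely many edges, for `k ≥ 1`: the
matroid on `E(G)` whose circuits are the members of `C_k(G)` (see `isCircuit_kCircularMatroid`),
that is, whose independent sets are the sets of edges containing no member of `C_k(G)`. -/
noncomputable def kCircularMatroid (G : Graph α β) (k : ℕ) (hk : 1 ≤ k) (hE : E(G).Finite) :
    Matroid β :=
  (IndepMatroid.ofFinite hE (G.KIndep k)
    ((G.kIndep_iff hk hE).2 ⟨Set.empty_subset _, fun Y hY => by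
      rw [Set.subset_empty_iff.1 hY]
      simp [excess, endSet]
      omega⟩)
    (fun _ _ hJ hIJ => ⟨hIJ.trans hJ.1, fun C hC h => hJ.2 C hC (h.trans hIJ)⟩)
    (fun _ _ hI hJ h => hI.augment hk hE hJ h)
    (fun _ hI => hI.1)).matroid

theorem kCircularMatroid_ground (G : Graph α β) {k : ℕ} (hk : 1 ≤ k) (hE : E(G).Finite) :
    (G.kCircularMatroid k hk hE).E = E(G) := rfl

theorem kCircularMatroid_indep_iff (G : Graph α β) {k : ℕ} (hk : 1 ≤ k) (hE : E(G).Finite)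
    {I : Set β} : (G.kCircularMatroid k hk hE).Indep I ↔ G.KIndep k I := Iff.rfl

/-- The circuits of `M_k(G)` are exactly the members of `C_k(G)`. -/
theorem isCircuit_kCircularMatroid (G : Graph α β) {k : ℕ} (hk : 1 ≤ k) (hE : E(G).Finite)
    {C : Set β} : (G.kCircularMatroid k hk hE).IsCircuit C ↔ G.IsKCircuit k C := by
  rw [Matroid.isCircuit_iff_forall_ssubset]
  constructor
  · rintro ⟨hdep, hmin⟩
    have hCE : C ⊆ E(G) := hdep.subset_ground
    have h : ¬ G.KIndep k C := hdep.not_indep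
    unfold KIndep at h
    push Not at h
    obtain ⟨D, hD, hDC⟩ := h hCE
    obtain rfl | hss := hDC.eq_or_ssubset
    · exact hD
    · exact absurd subset_rfl ((hmin hss).2 D hD)
  · intro hC
    refine ⟨⟨fun h => h.2 C hC subset_rfl, hC.1⟩, fun D hDC => ?_⟩
    refine (G.kIndep_iff hk hE).2 ⟨hDC.subset.trans hC.1, fun Y hY => ?_⟩
    exact hC.excess_lt (hE.subset hC.1) (hY.trans_ssubset hDC)

end Graph

namespace Matroid

variable {β : Type*}

/-- A matroid is connected if it has no loops, no coloops, and every two elements belong to a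
common circuit. -/
def IsConnected (M : Matroid β) : Prop :=
  (∀ e, ¬ M.IsLoop e) ∧ (∀ e, ¬ M.IsColoop e) ∧
    ∀ e ∈ M.E, ∀ f ∈ M.E, e ≠ f → ∃ C, M.IsCircuit C ∧ e ∈ C ∧ f ∈ C

/-- A non-separating cocircuit of a (connected) matroid `M`: a cocircuit whose deletion leaves
a connected matroid. -/
def IsNonseparatingCocircuit (M : Matroid β) (K : Set β) : Prop :=
  M.IsCocircuit K ∧ (M ＼ K).IsConnected

end Matroid

/-!
An independent set of `M_k(G)` has excess at most `k - 1`, so a set `X` of edges has rank at most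
`|V(X)| + k - 1`, where `V(X)` is the set of ends of `X`. If `X` is nonempty and the restriction to
`X` has no coloops, a basis of `X` is the union of the sets `C \ {e}`, one for the fundamental
circuit `C` of each edge `e` of `X` outside the basis. Each of these sets is tight (excess
`k - 1`), and by supermodularity of the excess so is their union; hence the rank of `X` is
exactly `|V(X)| + k - 1`.

Now suppose that `M_k(G)` has no coloops, and let `K` be a cocircuit whose complement has no
coloops. The complement does not span, so by the rank formula it misses a vertex `v`. The star of
`v` lies in `K` and its complement does not span either, so `K` is the star of `v` by minimality.
Thus every star of `G` is a star of `G'`. Distinct vertices have distinct stars, since the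
complement of a cocircuit has corank one and therefore misses only one vertex, and `G` and `G'`
have equally many vertices by the rank formula. So vertices with equal stars are matched by a
bijection.
-/

section

variable {β : Type*} {M : Matroid β}

theorem iUnion_fundCircuit_sdiff_singleton_eq {I X : Set β} (hI : M.IsBasis I X)
    (hX : (M ↾ X).coloops = ∅) : ⋃ e ∈ X \ I, M.fundCircuit e I \ {e} = I := by
  refine Set.Subset.antisymm (Set.iUnion₂_subset fun e _ ↦ ?_) fun f hf ↦ ?_
  · exact Set.sdiff_singleton_subset_iff.2 (M.fundCircuit_subset_insert e I)
  · have hf' : ¬ (M ↾ X).IsColoop f := by simp [Matroid.isColoop_iff_mem_coloops, hX]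
    rw [hI.isBase_restrict.isColoop_iff_forall_notMem_fundCircuit hf] at hf'
    push Not at hf'
    obtain ⟨e, he, hfe⟩ := hf'
    rw [Matroid.restrict_ground_eq] at he
    rw [M.fundCircuit_restrict hI.subset he.1 hI.subset_ground] at hfe
    exact Set.mem_biUnion he ⟨hfe, fun h ↦ he.2 (h ▸ hf)⟩

theorem eRank_le_eRk_compl_add_one_of_isCocircuit {K : Set β} (hK : M.IsCocircuit K) :
    M.eRank ≤ M.eRk (M.E \ K) + 1 := by
  obtain ⟨e, he⟩ := hK.nonempty
  have hspan : M.Spanning (M.E \ (K \ {e})) := by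
    rw [Matroid.isCocircuit_iff_minimal_compl_nonspanning] at hK
    exact not_not.1 (hK.not_prop_of_ssubset (Set.sdiff_singleton_ssubset.2 he))
  calc M.eRank = M.eRk (M.E \ (K \ {e})) := hspan.eRk_eq.symm
    _ ≤ M.eRk (insert e (M.E \ K)) := M.eRk_mono (by grind)
    _ ≤ M.eRk (M.E \ K) + 1 := M.eRk_insert_le_add_one e _

end

section

variable {α α' β : Type*} {G : Graph α β} {G' : Graph α' β}

theorem endSet_subset_endSet_edgeSet (G : Graph α β) (X : Set β) :
    G.endSet X ⊆ G.endSet E(G) :=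
  fun _ ⟨e, _, hv⟩ ↦ ⟨e, hv.edge_mem, hv⟩

theorem endSet_edgeSet (hiso : ∀ v ∈ V(G), ∃ e, G.Inc e v) : G.endSet E(G) = V(G) :=
  Set.Subset.antisymm (fun _ ⟨_, _, hv⟩ ↦ hv.vertex_mem) fun v hv ↦
    (hiso v hv).imp fun _ he ↦ ⟨he.edge_mem, he⟩

theorem notMem_endSet_edgeSet_sdiff_incidenceSet (G : Graph α β) (v : α) :
    v ∉ G.endSet (E(G) \ G.incidenceSet v) :=
  fun ⟨_, he, hv⟩ ↦ he.2 hv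

theorem starSet_eq_range (G : Graph α β) :
    G.starSet = Set.range fun v : V(G) ↦ G.incidenceSet v := by
  ext S
  simp only [Graph.starSet, Set.mem_ofPred_eq, Set.mem_range, Subtype.exists, exists_prop,
    eq_comm]

theorem starSet_eq_of_incidenceSet_eq (ν : V(G) ≃ V(G'))
    (hν : ∀ v : V(G), G.incidenceSet v = G'.incidenceSet (ν v)) : G.starSet = G'.starSet := by
  rw [starSet_eq_range, starSet_eq_range, funext hν]
  exact ν.surjective.range_comp fun v : V(G') ↦ G'.incidenceSet v

theorem isLink_coe_iff_inc {e : β} {x y : V(G)} :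
    G.IsLink e x y ↔ G.Inc e x ∧ G.Inc e y ∧ ∀ z : V(G), G.Inc e z → z = x ∨ z = y := by
  simp only [Graph.isLink_iff_inc, Subtype.ext_iff, Subtype.forall]
  exact and_congr_right' (and_congr_right'
    ⟨fun h z _ hz ↦ h z hz, fun h z hz ↦ h z hz.vertex_mem hz⟩)

theorem edgeSet_eq_iUnion_incidenceSet (G : Graph α β) :
    E(G) = ⋃ v : V(G), G.incidenceSet v := by
  refine Set.Subset.antisymm (fun e he ↦ ?_)
    (Set.iUnion_subset fun v ↦ G.incidenceSet_subset_edgeSet v)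
  obtain ⟨v, _, hv⟩ := Graph.exists_isLink_of_mem_edgeSet he
  exact Set.mem_iUnion.2 ⟨⟨v, hv.left_mem⟩, hv.inc_left⟩

theorem stronglyIsomorphic_of_incidenceSet_eq (ν : V(G) ≃ V(G'))
    (hν : ∀ v : V(G), G.incidenceSet v = G'.incidenceSet (ν v)) : G.StronglyIsomorphic G' := by
  refine ⟨?_, ν, fun e x y ↦ ?_⟩
  · rw [edgeSet_eq_iUnion_incidenceSet G, edgeSet_eq_iUnion_incidenceSet G']
    exact ν.iSup_congr fun v ↦ (hν v).symm
  · have hinc (v : V(G)) : G.Inc e v ↔ G'.Inc e (ν v) := Set.ext_iff.1 (hν v) e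
    rw [isLink_coe_iff_inc, isLink_coe_iff_inc, hinc, hinc]
    refine and_congr_right' (and_congr_right' (ν.forall_congr fun {z} ↦ ?_))
    rw [hinc, ν.apply_eq_iff_eq, ν.apply_eq_iff_eq]

end

/-- A tight edge set has excess `k - 1`, the largest excess an independent set of the
`k`-circular matroid can have; the definition is additive to avoid natural subtraction. -/
def IsKTight {α β : Type*} (G : Graph α β) (k : ℕ) (T : Set β) : Prop :=
  G.excess T + 1 = k

section

variable {α α' β : Type*} {G : Graph α β} {G' : Graph α' β} {k : ℕ} {hk : 1 ≤ k}
  {hE : E(G).Finite} {hE' : E(G').Finite}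

instance kCircularMatroid_finite : (G.kCircularMatroid k hk hE).Finite :=
  ⟨hE⟩

theorem isKTight_and_endSet_eq_sdiff_singleton {C : Set β} (hC : G.IsKCircuit k C)
    (hCf : C.Finite) {e : β} (he : e ∈ C) :
    IsKTight G k (C \ {e}) ∧ G.endSet (C \ {e}) = G.endSet C := by
  have hCk : G.excess C = k := G.edgeInduced_delta hC.1 ▸ hC.2.1
  have hlt := hC.excess_lt hCf (Set.sdiff_singleton_ssubset.2 he)
  have hcard := Set.ncard_sdiff_singleton_add_one he hCf
  have hsub : G.endSet (C \ {e}) ⊆ G.endSet C := G.endSet_mono Set.sdiff_subset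
  have hle := Set.ncard_le_ncard hsub (G.endSet_finite hCf)
  unfold IsKTight
  unfold Graph.excess at *
  exact ⟨by omega, Set.eq_of_subset_of_ncard_le hsub (by omega) (G.endSet_finite hCf)⟩

theorem excess_lt_of_indep {I : Set β} (hI : (G.kCircularMatroid k hk hE).Indep I) :
    G.excess I < k :=
  ((G.kIndep_iff hk hE).1 hI).2 I subset_rfl

theorem supClosed_isKTight {I : Set β} (hI : (G.kCircularMatroid k hk hE).Indep I) :
    SupClosed {T | T ⊆ I ∧ IsKTight G k T} := by
  rintro S ⟨hSI, hS⟩ T ⟨hTI, hT⟩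
  have hfin {Y : Set β} (hY : Y ⊆ I) : Y.Finite := hE.subset (hY.trans hI.subset_ground)
  have hsuper := G.excess_supermodular (hfin hSI) (hfin hTI)
  have hunion := excess_lt_of_indep (hI.subset (Set.union_subset hSI hTI))
  have hinter := excess_lt_of_indep (hI.subset (Set.inter_subset_left.trans hSI : S ∩ T ⊆ I))
  refine ⟨Set.union_subset hSI hTI, ?_⟩
  change G.excess (S ∪ T) + 1 = k
  unfold IsKTight at hS hT
  omega

theorem eRk_kCircularMatroid_add_one_le (X : Set β) :
    (G.kCircularMatroid k hk hE).eRk X + 1 ≤ (G.endSet X).encard + k := by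
  obtain ⟨I, hI⟩ := (G.kCircularMatroid k hk hE).exists_isBasis' X
  have hIf : I.Finite := hE.subset hI.indep.subset_ground
  have hlt := excess_lt_of_indep hI.indep
  calc (G.kCircularMatroid k hk hE).eRk X + 1 = I.ncard + 1 := by
        rw [← hI.encard_eq_eRk, hIf.cast_ncard_eq]
    _ ≤ (G.endSet I).ncard + k := by
        unfold Graph.excess at hlt
        norm_cast
        omega
    _ = (G.endSet I).encard + k := by rw [(G.endSet_finite hIf).cast_ncard_eq]
    _ ≤ (G.endSet X).encard + k := by gcongr; exact G.endSet_mono hI.subset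

theorem isKTight_and_endSet_eq_of_isBasis {I X : Set β}
    (hI : (G.kCircularMatroid k hk hE).IsBasis I X) (hne : X.Nonempty)
    (hX : (G.kCircularMatroid k hk hE ↾ X).coloops = ∅) :
    IsKTight G k I ∧ G.endSet I = G.endSet X := by
  set M := G.kCircularMatroid k hk hE
  have hunion := iUnion_fundCircuit_sdiff_singleton_eq hI hX
  have hfund {e : β} (he : e ∈ X \ I) : IsKTight G k (M.fundCircuit e I \ {e}) ∧
      G.endSet (M.fundCircuit e I \ {e}) = G.endSet (M.fundCircuit e I) := by
    have hC : M.IsCircuit (M.fundCircuit e I) :=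
      hI.indep.fundCircuit_isCircuit (hI.subset_closure he.1) he.2
    exact isKTight_and_endSet_eq_sdiff_singleton ((G.isCircuit_kCircularMatroid hk hE).1 hC)
      (hE.subset hC.subset_ground) (M.mem_fundCircuit e I)
  have hsub {e : β} (he : e ∈ X \ I) : M.fundCircuit e I \ {e} ⊆ I :=
    (Set.subset_biUnion_of_mem he).trans hunion.subset
  have hne' : (X \ I).Nonempty := by
    by_contra! h
    rw [h, Set.biUnion_empty] at hunion
    rw [← hunion, Set.sdiff_empty] at h
    exact hne.ne_empty h
  constructor
  · have htight := (supClosed_isKTight hI.indep).biSup_mem_of_nonempty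
      (hE.subset (Set.sdiff_subset.trans hI.subset_ground)) hne' fun e he ↦ ⟨hsub he, (hfund he).1⟩
    exact hunion ▸ htight.2
  · refine (G.endSet_mono hI.subset).antisymm fun v ⟨e, he, hv⟩ ↦ ?_
    by_cases heI : e ∈ I
    · exact ⟨e, heI, hv⟩
    · refine G.endSet_mono (hsub ⟨he, heI⟩) ?_
      rw [(hfund ⟨he, heI⟩).2]
      exact ⟨e, M.mem_fundCircuit e I, hv⟩

theorem eRk_kCircularMatroid_add_one_eq {X : Set β} (hXE : X ⊆ E(G)) (hne : X.Nonempty)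
    (hX : (G.kCircularMatroid k hk hE ↾ X).coloops = ∅) :
    (G.kCircularMatroid k hk hE).eRk X + 1 = (G.endSet X).encard + k := by
  obtain ⟨I, hI⟩ := (G.kCircularMatroid k hk hE).exists_isBasis X hXE
  obtain ⟨htight, hend⟩ := isKTight_and_endSet_eq_of_isBasis hI hne hX
  have hIf : I.Finite := hE.subset hI.indep.subset_ground
  rw [← hI.encard_eq_eRk, ← hend, ← hIf.cast_ncard_eq, ← (G.endSet_finite hIf).cast_ncard_eq]
  unfold IsKTight Graph.excess at htight
  norm_cast
  omega

theorem eRank_kCircularMatroid_add_one_eq (hne : E(G).Nonempty)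
    (hcoloops : (G.kCircularMatroid k hk hE).coloops = ∅) :
    (G.kCircularMatroid k hk hE).eRank + 1 = (G.endSet E(G)).encard + k := by
  rw [← Matroid.eRk_ground]
  exact eRk_kCircularMatroid_add_one_eq subset_rfl hne (by rwa [Matroid.restrict_ground_eq_self])

theorem spanning_of_endSet_edgeSet_subset {X : Set β} (hXE : X ⊆ E(G)) (hne : X.Nonempty)
    (hX : (G.kCircularMatroid k hk hE ↾ X).coloops = ∅) (hend : G.endSet E(G) ⊆ G.endSet X) :
    (G.kCircularMatroid k hk hE).Spanning X := by
  rw [Matroid.spanning_iff_eRk_le hXE, ← Matroid.eRk_ground,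
    ← ENat.add_le_add_iff_right ENat.one_ne_top, eRk_kCircularMatroid_add_one_eq hXE hne hX]
  exact (eRk_kCircularMatroid_add_one_le E(G)).trans (by gcongr)

theorem not_spanning_of_notMem_endSet (hcoloops : (G.kCircularMatroid k hk hE).coloops = ∅)
    {X : Set β} {v : α} (hv : v ∈ G.endSet E(G)) (hvX : v ∉ G.endSet X) :
    ¬ (G.kCircularMatroid k hk hE).Spanning X := by
  intro hspan
  have hne : E(G).Nonempty := hv.imp fun _ he ↦ he.1
  have hsub := endSet_subset_endSet_edgeSet G X
  have hlt : (G.endSet X).encard < (G.endSet E(G)).encard :=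
    ((G.endSet_finite hE).subset hsub).encard_lt_encard
      ((Set.ssubset_iff_of_subset hsub).2 ⟨v, hv, hvX⟩)
  refine ((ENat.add_lt_add_iff_right (ENat.natCast_ne_top k)).2 hlt).not_ge ?_
  rw [← eRank_kCircularMatroid_add_one_eq hne hcoloops, ← hspan.eRk_eq]
  exact eRk_kCircularMatroid_add_one_le X

theorem exists_incidenceSet_eq_of_isCocircuit
    (hcoloops : (G.kCircularMatroid k hk hE).coloops = ∅) {K : Set β}
    (hK : (G.kCircularMatroid k hk hE).IsCocircuit K)
    (hcompl : (G.kCircularMatroid k hk hE ＼ K).coloops = ∅) :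
    ∃ v ∈ V(G), G.incidenceSet v = K := by
  have hmin := Matroid.isCocircuit_iff_minimal_compl_nonspanning.1 hK
  obtain ⟨v, hv, hvK⟩ : ∃ v ∈ G.endSet E(G), v ∉ G.endSet (E(G) \ K) := by
    by_contra! hcover
    obtain ⟨e, he⟩ := hK.nonempty
    have heE : e ∈ E(G) := hK.subset_ground he
    obtain ⟨v, _, hev⟩ := Graph.exists_isLink_of_mem_edgeSet heE
    have hne : (E(G) \ K).Nonempty :=
      (hcover v ⟨e, heE, hev.inc_left⟩).imp fun _ hf ↦ hf.1
    exact hmin.prop (spanning_of_endSet_edgeSet_subset Set.sdiff_subset hne hcompl hcover)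
  have hsub : G.incidenceSet v ⊆ K := fun e he ↦
    by_contra fun heK ↦ hvK ⟨e, ⟨he.edge_mem, heK⟩, he⟩
  have hnonspan := not_spanning_of_notMem_endSet hcoloops hv
    (notMem_endSet_edgeSet_sdiff_incidenceSet G v)
  obtain ⟨_, _, hev⟩ := hv
  exact ⟨v, hev.vertex_mem, hmin.eq_of_subset hnonspan hsub⟩

theorem encard_endSet_edgeSet_le_of_isCocircuit
    (hcoloops : (G.kCircularMatroid k hk hE).coloops = ∅) {K : Set β}
    (hK : (G.kCircularMatroid k hk hE).IsCocircuit K) :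
    (G.endSet E(G)).encard ≤ (G.endSet (E(G) \ K)).encard + 1 := by
  have hne : E(G).Nonempty := hK.nonempty.mono hK.subset_ground
  rw [← ENat.add_le_add_iff_right (ENat.natCast_ne_top k)]
  calc (G.endSet E(G)).encard + k
    _ = (G.kCircularMatroid k hk hE).eRank + 1 :=
        (eRank_kCircularMatroid_add_one_eq hne hcoloops).symm
    _ ≤ (G.kCircularMatroid k hk hE).eRk (E(G) \ K) + 1 + 1 := by
        gcongr
        exact eRank_le_eRk_compl_add_one_of_isCocircuit hK
    _ ≤ (G.endSet (E(G) \ K)).encard + k + 1 :=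
        add_le_add (eRk_kCircularMatroid_add_one_le _) le_rfl
    _ = (G.endSet (E(G) \ K)).encard + 1 + k := add_right_comm _ _ _

theorem injOn_incidenceSet (hcoloops : (G.kCircularMatroid k hk hE).coloops = ∅) :
    {v | (G.kCircularMatroid k hk hE).IsCocircuit (G.incidenceSet v)}.InjOn G.incidenceSet := by
  intro u hu v hv huv
  by_contra hne
  set W := G.endSet (E(G) \ G.incidenceSet u) with hW
  have huW : u ∉ W := notMem_endSet_edgeSet_sdiff_incidenceSet G u
  have hvW : v ∉ W := by
    rw [hW, huv]
    exact notMem_endSet_edgeSet_sdiff_incidenceSet G v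
  have hmem {w : α} (hw : (G.kCircularMatroid k hk hE).IsCocircuit (G.incidenceSet w)) :
      w ∈ G.endSet E(G) := hw.nonempty.imp fun _ he ↦ ⟨he.edge_mem, he⟩
  have hle : (G.endSet E(G)).encard ≤ W.encard + 1 :=
    encard_endSet_edgeSet_le_of_isCocircuit hcoloops hu
  have hge : W.encard + 1 + 1 ≤ (G.endSet E(G)).encard := by
    have huvW : u ∉ insert v W := by simp [hne, huW]
    rw [← Set.encard_insert_of_notMem hvW, ← Set.encard_insert_of_notMem huvW]
    exact Set.encard_le_encard (Set.insert_subset (hmem hu)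
      (Set.insert_subset (hmem hv) (endSet_subset_endSet_edgeSet G _)))
  have hfin : W.encard + 1 ≠ ⊤ := by
    simpa using G.endSet_finite (hE.subset Set.sdiff_subset)
  exact ((ENat.add_one_le_iff hfin).1 (hge.trans hle)).false

theorem encard_endSet_edgeSet_eq
    (heq : G.kCircularMatroid k hk hE = G'.kCircularMatroid k hk hE')
    (hcoloops : (G.kCircularMatroid k hk hE).coloops = ∅) :
    (G.endSet E(G)).encard = (G'.endSet E(G')).encard := by
  have hEE : E(G) = E(G') := congrArg Matroid.E heq
  obtain hempty | hne := E(G).eq_empty_or_nonempty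
  · simp [← hEE, hempty, Graph.endSet]
  · have hrank := eRank_kCircularMatroid_add_one_eq hne hcoloops
    have hrank' := eRank_kCircularMatroid_add_one_eq (hEE ▸ hne) (heq ▸ hcoloops)
    rw [← heq, hrank] at hrank'
    exact ENat.add_left_injective_of_ne_top (ENat.natCast_ne_top k) hrank'

end

theorem mainTheorem8_general {α α' β : Type*} (G : Graph α β) (G' : Graph α' β) (k : ℕ)
    (hk : 1 ≤ k) (hE : E(G).Finite) (hE' : E(G').Finite)
    (hiso' : ∀ v ∈ V(G'), ∃ e, G'.Inc e v)
    (hcoloops : (G.kCircularMatroid k hk hE).coloops = ∅)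
    (hstars : ∀ S ∈ G.starSet, (G.kCircularMatroid k hk hE).IsCocircuit S ∧
      (G.kCircularMatroid k hk hE ＼ S).coloops = ∅)
    (heq : G.kCircularMatroid k hk hE = G'.kCircularMatroid k hk hE') :
    G.starSet = G'.starSet ∧ G.StronglyIsomorphic G' := by
  have hstar (v : V(G)) := hstars (G.incidenceSet v) ⟨v, v.2, rfl⟩
  have hiso : ∀ v ∈ V(G), ∃ e, G.Inc e v := fun v hv ↦ (hstar ⟨v, hv⟩).1.nonempty
  have hexists (v : V(G)) : ∃ w : V(G'), G'.incidenceSet w = G.incidenceSet v := by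
    rw [heq] at hcoloops hstar
    obtain ⟨w, hw, hvw⟩ :=
      exists_incidenceSet_eq_of_isCocircuit hcoloops (hstar v).1 (hstar v).2
    exact ⟨⟨w, hw⟩, hvw⟩
  choose ν hν using hexists
  have hinj : ν.Injective := fun u v huv ↦ Subtype.ext <|
    injOn_incidenceSet hcoloops (hstar u).1 (hstar v).1 (by rw [← hν, ← hν, huv])
  have hcard : Nat.card V(G') ≤ Nat.card V(G) := by
    rw [← endSet_edgeSet hiso, ← endSet_edgeSet hiso', Nat.card_coe_set_eq, Nat.card_coe_set_eq,
      Set.ncard, Set.ncard, encard_endSet_edgeSet_eq heq hcoloops]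
  have : Finite V(G') := endSet_edgeSet hiso' ▸ G'.endSet_finite hE'
  let φ := Equiv.ofBijective ν (hinj.bijective_of_nat_card_le hcard)
  have hφ (v : V(G)) : G.incidenceSet v = G'.incidenceSet (φ v) := (hν v).symm
  exact ⟨starSet_eq_of_incidenceSet_eq φ hφ, stronglyIsomorphic_of_incidenceSet_eq φ hφ⟩

theorem mainTheorem8 {α α' β : Type*} (G : Graph α β) (G' : Graph α' β) (k : ℕ) (hk : 1 ≤ k)
    (hV : V(G).Finite) (hE : E(G).Finite) (hV' : V(G').Finite) (hE' : E(G').Finite)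
    (hiso' : ∀ v ∈ V(G'), ∃ e, G'.Inc e v)
    (hconn : (G.kCircularMatroid k hk hE).IsConnected)
    (hstars : ∀ S ∈ G.starSet, (G.kCircularMatroid k hk hE).IsNonseparatingCocircuit S)
    (heq : G.kCircularMatroid k hk hE = G'.kCircularMatroid k hk hE') :
    G.starSet = G'.starSet ∧ G.StronglyIsomorphic G' :=
  mainTheorem8_general G G' k hk hE hE' hiso' (Set.eq_empty_of_forall_notMem hconn.2.1)
    (fun S hS ↦ ⟨(hstars S hS).1, Set.eq_empty_of_forall_notMem (hstars S hS).2.2.1⟩) heq
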